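/- Let $q\ge 0$ and let $B_{i,j}$ ($1\le i,j\le q$) be independent commuting indeterminates. A finite (possibly empty) sequence of positive integers is called admissible if, for every $s$, between any two appearances of $s$ in it there is an entry greater than $s$. For $1\le n\le q$ let $D_n$ be the (finite) set of admissible sequences with all entries in $\{1,\dots,n-1\}$, including the empty sequence, and put $$C_{n,n}=\sum_{(i_1,\dots,i_c)\in D_n}B_{n,i_1}B_{i_1,i_2}\cdots B_{i_{c-1},i_c}B_{i_c,n}\in\mathbb Z[B_{i,j}],$$ where the empty sequence contributes $B_{n,n}$. Let $I\subset\mathbb Z[B_{i,j}]$ be the ideal generated by the polynomials $$\det\bigl(B_{i,j}\bigr)_{1\le i,j\le n}-(-1)^n,\qquad n=1,\dots,q.$$ Let $\prec$ be any total order of the indeterminates in which every diagonal $B_{i,i}$ is larger than every off-diagonal $B_{j,k}$ ($j\ne k$), extended lexicographically to the monomials (monomials are compared by their exponents at the largest indeterminate where they differ). The initial ideal of $I$ is the ideal generated by the leading terms (with their coefficients) of all elements of $I$. A Gröbner basis of $I$ is a finite subset $G\subset I$ whose leading terms generate the initial ideal; it is reduced if every $g\in G$ has leading coefficient $1$ and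 no monomial occurring in $g$ is divisible by the leading monomial of another element of $G$. Theorem. With respect to $\prec$, the set $\{\,1+C_{n,n} : n=1,\dots,q\,\}$ is the reduced Gröbner basis of $I$ (it is a reduced Gröbner basis of $I$, and the only one). The initial ideal of $I$ is generated by $B_{1,1},\dots,B_{q,q}$. -/

import Mathlib

open MvPolynomial

/-- The lexicographic term order attached to an order `o` of the indeterminates: two monomials are
compared by their exponents at the `o`-largest indeterminate where they differ. (`MonomialOrder.lex`
takes the smallest index to be the most significant one, so the order is reversed.) -/
noncomputable def lexTermOrder {σ : Type*} [Finite σ] (o : LinearOrder σ) : MonomialOrder σ :=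
  letI : LinearOrder σ := inferInstanceAs (LinearOrder σᵒᵈ)
  MonomialOrder.lex

theorem lexTermOrder_lt_iff {σ : Type*} [Finite σ] (o : LinearOrder σ) (c d : σ →₀ ℕ) :
    (lexTermOrder o).toSyn c < (lexTermOrder o).toSyn d ↔
      ∃ v, (∀ w, o.lt v w → c w = d w) ∧ c v < d v :=
  Iff.rfl

/-- The initial ideal: it is generated by the leading terms (coefficients included) of all
elements of `I`. -/
noncomputable def initialIdeal {σ R : Type*} [CommRing R] (m : MonomialOrder σ)
    (I : Ideal (MvPolynomial σ R)) : Ideal (MvPolynomial σ R) :=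
  Ideal.span (m.leadingTerm '' (I : Set (MvPolynomial σ R)))

/-- `G` is a Gröbner basis of `I`: a finite subset of `I` whose leading terms generate
the initial ideal of `I`. -/
structure IsGroebnerBasis {σ R : Type*} [CommRing R] (m : MonomialOrder σ)
    (G : Set (MvPolynomial σ R)) (I : Ideal (MvPolynomial σ R)) : Prop where
  finite : G.Finite
  subset : G ⊆ I
  span_leadingTerm : Ideal.span (m.leadingTerm '' G) = initialIdeal m I

/-- A Gröbner basis is reduced if all leading coefficients are `1` and no monomial occurring in an
element `g` of it is divisible by the leading monomial of another element `h`.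
(`m.degree h ≤ a`, compared exponent by exponent, is divisibility of monomials.) -/
structure IsReducedGroebnerBasis {σ R : Type*} [CommRing R] (m : MonomialOrder σ)
    (G : Set (MvPolynomial σ R)) (I : Ideal (MvPolynomial σ R)) : Prop
    extends IsGroebnerBasis m G I where
  monic : ∀ g ∈ G, m.Monic g
  reduced : ∀ g ∈ G, ∀ h ∈ G, h ≠ g → ∀ a ∈ g.support, ¬ m.degree h ≤ a

/-- Between any two appearances of the same `s` there is an entry greater than `s`. -/
def IsAdmissible {α : Type*} [LT α] (l : List α) : Prop :=
  ∀ i j : Fin l.length, i < j → l.get i = l.get j →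
    ∃ k : Fin l.length, i < k ∧ k < j ∧ l.get i < l.get k

/-- The admissible sequences all of whose entries are smaller than `n` (the empty sequence
included). -/
def admissibleBelow {q : ℕ} (n : Fin q) : Set (List (Fin q)) :=
  {l | IsAdmissible l ∧ ∀ s ∈ l, s < n}

theorem IsAdmissible.of_append {α : Type*} [LT α] {a b c : List α}
    (h : IsAdmissible (a ++ b ++ c)) : IsAdmissible b := by
  intro i j hij hs
  have hi := i.2
  have hj := j.2
  have e : ∀ (k : ℕ) (hk : k < b.length) (hk' : a.length + k < (a ++ b ++ c).length),
      (a ++ b ++ c)[a.length + k]'hk' = b[k] := by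
    intro k hk hk'
    rw [List.getElem_append_left (by simp; omega), List.getElem_append_right (by omega)]
    simp
  obtain ⟨k, h1, h2, h3⟩ := h ⟨a.length + i, by simp; omega⟩ ⟨a.length + j, by simp; omega⟩
    (by simpa using hij) (by simpa [e] using hs)
  obtain ⟨k, hk⟩ := k
  simp only [Fin.mk_lt_mk] at h1 h2
  obtain ⟨k, rfl⟩ : ∃ k', k = a.length + k' := ⟨k - a.length, by omega⟩
  refine ⟨⟨k, by omega⟩, ?_, ?_, ?_⟩
  · rw [Fin.lt_def]; simp; omega
  · rw [Fin.lt_def]; simp; omega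
  · have := e k (by omega) hk
    have := e i hi (by simp; omega)
    simp_all

theorem finite_admissible (q : ℕ) (n : ℕ) :
    {l : List (Fin q) | IsAdmissible l ∧ ∀ s ∈ l, (s : ℕ) < n}.Finite := by
  induction n with
  | zero =>
    refine (Set.finite_singleton ([] : List (Fin q))).subset ?_
    rintro l ⟨-, h⟩
    cases l with
    | nil => rfl
    | cons a l => exact absurd (h a (by simp)) (by omega)
  | succ n ih =>
    by_cases hn : n < q
    · refine (ih.union (Set.Finite.image2 (fun a b => a ++ (⟨n, hn⟩ : Fin q) :: b) ih ih)).subset ?_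
      rintro l ⟨hl, h⟩
      by_cases hm : (⟨n, hn⟩ : Fin q) ∈ l
      · right
        obtain ⟨a, b, rfl⟩ := List.append_of_mem hm
        have key : ∀ i j : Fin (a ++ (⟨n, hn⟩ : Fin q) :: b).length, i < j →
            (a ++ (⟨n, hn⟩ : Fin q) :: b).get i = ⟨n, hn⟩ →
            (a ++ (⟨n, hn⟩ : Fin q) :: b).get j = ⟨n, hn⟩ → False := by
          intro i j hij hi hj
          obtain ⟨k, -, -, hk⟩ := hl i j hij (hi.trans hj.symm)
          rw [hi] at hk
          have := h _ (List.get_mem _ k)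
          rw [Fin.lt_def] at hk
          simp only at hk
          omega
        have hmid : (a ++ (⟨n, hn⟩ : Fin q) :: b).get ⟨a.length, by simp⟩ = ⟨n, hn⟩ := by simp
        refine ⟨a, ⟨IsAdmissible.of_append (a := []) (c := ⟨n, hn⟩ :: b) (by simpa using hl), ?_⟩,
          b, ⟨IsAdmissible.of_append (a := a ++ [⟨n, hn⟩]) (c := []) (by simpa using hl), ?_⟩, rfl⟩
        · intro s hs
          obtain ⟨i, hi, rfl⟩ := List.getElem_of_mem hs
          have h1 := h _ (List.mem_append_left _ hs)
          by_contra hc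
          refine key ⟨i, by simp; omega⟩ ⟨a.length, by simp⟩ (by simpa using hi) ?_ hmid
          ext
          simp [List.getElem_append_left hi]
          omega
        · intro s hs
          obtain ⟨i, hi, rfl⟩ := List.getElem_of_mem hs
          have h1 := h _ (List.mem_append_right _ (List.mem_cons_of_mem _ hs))
          by_contra hc
          refine key ⟨a.length, by simp⟩ ⟨a.length + (i + 1), by simp; omega⟩
            (by rw [Fin.lt_def]; simp) hmid ?_
          ext
          simp
          omega
      · left
        refine ⟨hl, fun s hs => ?_⟩
        have h1 := h s hs
        have h2 : (s : ℕ) ≠ n := fun e => hm (by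
          have : s = ⟨n, hn⟩ := Fin.ext e
          rwa [this] at hs)
        omega
    · refine ih.subset ?_
      rintro l ⟨hl, h⟩
      exact ⟨hl, fun s hs => by have := s.2; omega⟩

theorem finite_admissibleBelow {q : ℕ} (n : Fin q) : (admissibleBelow n).Finite :=
  (finite_admissible q n).subset fun _ h => ⟨h.1, fun s hs => h.2 s hs⟩

/-- The product `B i i₁ * B i₁ i₂ * ⋯ * B i_c j` along the sequence `i₁, …, i_c`; it is `B i j` for
the empty sequence. -/
def seqProd {α S : Type*} [Mul S] (B : Matrix α α S) (i : α) : List α → α → S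
  | [], j => B i j
  | a :: l, j => B i a * seqProd B a l j

/-- The polynomial `C_{n,n}` in the indeterminates `B_{i,j}`. Rows and columns are numbered from `0`
here, so the value `n : Fin q` stands for the index `n + 1` in `1, …, q`. -/
noncomputable def diagC {q : ℕ} (n : Fin q) : MvPolynomial (Fin q × Fin q) ℤ :=
  ∑ l ∈ (finite_admissibleBelow n).toFinset,
    seqProd (Matrix.mvPolynomialX (Fin q) (Fin q) ℤ) n l n

/-- The upper left corner block of size `n + 1` of the generic matrix `(B_{i,j})`. -/
noncomputable def cornerBlock {q : ℕ} (n : Fin q) :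
    Matrix (Fin (n + 1)) (Fin (n + 1)) (MvPolynomial (Fin q × Fin q) ℤ) :=
  (Matrix.mvPolynomialX (Fin q) (Fin q) ℤ).submatrix (Fin.castLE n.isLt) (Fin.castLE n.isLt)

/-- The ideal generated by the shifted corner minors. -/
noncomputable def minorIdeal (q : ℕ) : Ideal (MvPolynomial (Fin q × Fin q) ℤ) :=
  Ideal.span (Set.range fun n : Fin q => (cornerBlock n).det - (-1) ^ ((n : ℕ) + 1))

/-! ### Gaussian elimination with pivots `-1`. -/

section Elimination

variable {S : Type*} [CommRing S] {q : ℕ}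

/-! Let `E m i j` sum the products along admissible sequences from `i` to `j` with entries below
`m`. Splitting at the only possible occurrence of `k` gives `E (k+1) i j = E k i j + E k i k * E k k
j` (`admissibleSum_succ`). Where the pivot `E k k k`, which is `diagC k`, equals `-1`, this is a
Gaussian elimination step, so a corner minor is the next pivot up to sign
(`det_corner_of_elimination`). Induction in the quotients then identifies the two ideals
(`minorIdeal_eq_span`). Each generator `1 + diagC n` is `X (n, n)` plus a polynomial in off-diagonal
indeterminates. Hence its leading term is `X (n, n)`, and the ideal is the kernel of a substitution
for the diagonal, meeting the off-diagonal polynomials only in `0` (`eq_zero_of_mem_minorIdeal`).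
This vanishing yields both the initial ideal and uniqueness. -/

/-- The rows of the pivots that have been used vanish. -/
theorem elimination_row_eq_zero {E : ℕ → Matrix (Fin q) (Fin q) S} {n : ℕ} (hn : n ≤ q)
    (hE : ∀ k i j : Fin q, E (k + 1) i j = E k i j + E k i k * E k k j)
    (hpiv : ∀ k : Fin q, (k : ℕ) < n → E k k k = -1) :
    ∀ m ≤ n, ∀ k : Fin q, (k : ℕ) < m → ∀ j, E m k j = 0 := by
  intro m
  induction m with
  | zero => intro _ k hk; omega
  | succ m ih =>
    intro hm k hk j
    have h := hE ⟨m, by omega⟩ k j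
    simp only at h
    rw [h]
    rcases Nat.lt_succ_iff_lt_or_eq.mp hk with hk | hk
    · rw [ih (by omega) k hk, ih (by omega) k hk]; simp
    · have hp := hpiv k (by omega)
      subst hk
      rw [hp]; ring

/-- Telescoping the recurrence writes `E m - E 0` as a sum of `m` rank-one matrices, the source of
the LU factorization. -/
theorem elimination_eq_add_sum {E : ℕ → Matrix (Fin q) (Fin q) S}
    (hE : ∀ k i j : Fin q, E (k + 1) i j = E k i j + E k i k * E k k j) (i j : Fin q) :
    ∀ (m : ℕ) (hm : m ≤ q), E m i j =
      E 0 i j + ∑ k : Fin m, E k i (Fin.castLE hm k) * E k (Fin.castLE hm k) j := by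
  intro m
  induction m with
  | zero => intro hm; simp
  | succ m ih =>
    intro hm
    have h := hE ⟨m, by omega⟩ i j
    simp only at h
    rw [h, ih (by omega), Fin.sum_univ_castSucc, add_assoc]
    rfl

/-- If every pivot before `n` is `-1`, then the corner minor of size `n + 1` is the next pivot up to
sign. -/
theorem det_corner_of_elimination {E : ℕ → Matrix (Fin q) (Fin q) S} (n : Fin q)
    (hE : ∀ k i j : Fin q, E (k + 1) i j = E k i j + E k i k * E k k j)
    (hpiv : ∀ k : Fin q, k < n → E k k k = -1) :
    ((E 0).submatrix (Fin.castLE n.isLt) (Fin.castLE n.isLt) :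
      Matrix (Fin (n + 1)) (Fin (n + 1)) S).det = (-1) ^ (n : ℕ) * E n n n := by
  have hrow : ∀ m ≤ (n : ℕ), ∀ k : Fin q, (k : ℕ) < m → ∀ j, E m k j = 0 :=
    elimination_row_eq_zero n.isLt.le hE fun k hk => hpiv k hk
  -- The recurrence is invariant under transposition.
  have hcol : ∀ m ≤ (n : ℕ), ∀ k : Fin q, (k : ℕ) < m → ∀ i, E m i k = 0 :=
    elimination_row_eq_zero (E := fun m => (E m).transpose) n.isLt.le
      (fun k i j => by simp [hE k j i, mul_comm]) fun k hk => hpiv k hk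
  let c : Fin (n + 1) → Fin q := Fin.castLE n.isLt
  have hc : c (Fin.last n) = n := Fin.ext rfl
  -- On the corner, only the last row of `E n` survives; it is absorbed as the last row of `U`. The
  -- diagonal of `L` is all `1`; that of `U` is `-1` followed by the last pivot `E n n n`.
  let L : Matrix (Fin (n + 1)) (Fin (n + 1)) S := fun i k =>
    Fin.lastCases (motive := fun _ => S) (if i = Fin.last n then 1 else 0)
      (fun k : Fin n => -E k (c i) (c k.castSucc)) k
  let U : Matrix (Fin (n + 1)) (Fin (n + 1)) S := fun k j =>
    Fin.lastCases (motive := fun _ => S) (E n n (c j))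
      (fun k : Fin n => E k (c k.castSucc) (c j)) k
  have hLU : (E 0).submatrix c c = L * U := by
    ext i j
    have h := elimination_eq_add_sum hE (c i) (c j) n n.isLt.le
    have h1 : E n (c i) (c j) = (if i = Fin.last n then 1 else 0) * E n n (c j) := by
      split_ifs with hi
      · rw [hi, hc, one_mul]
      · rw [zero_mul]
        exact hrow n le_rfl _ (Fin.val_lt_last hi) _
    rw [h1, ← sub_eq_iff_eq_add] at h
    rw [Matrix.mul_apply, Fin.sum_univ_castSucc]
    simp only [L, U, Fin.lastCases_last, Fin.lastCases_castSucc, Matrix.submatrix_apply, ← h,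
      neg_mul, Finset.sum_neg_distrib]
    rw [sub_eq_neg_add]
    rfl
  have hL : L.IsLowerTriangular := by
    intro i k hik
    replace hik : i < k := hik
    induction k using Fin.lastCases with
    | last => simp [L, hik.ne]
    | cast k =>
      simp only [L, Fin.lastCases_castSucc]
      rw [hrow k k.isLt.le _ (by exact hik), neg_zero]
  have hU : U.IsUpperTriangular := by
    intro k j hjk
    replace hjk : j < k := hjk
    induction k using Fin.lastCases with
    | last => simpa [U] using hcol n le_rfl _ (by exact hjk) _
    | cast k =>
      simp only [U, Fin.lastCases_castSucc]
      exact hcol k k.isLt.le _ (by exact hjk) _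
  have hp (k : Fin n) : E k (c k.castSucc) (c k.castSucc) = -1 := hpiv (c k.castSucc) k.isLt
  change ((E 0).submatrix c c).det = _
  rw [hLU, Matrix.det_mul, Matrix.det_of_isLowerTriangular _ hL, Matrix.det_of_isUpperTriangular hU,
    Fin.prod_univ_castSucc, Fin.prod_univ_castSucc]
  simp [L, U, hp, hc]

end Elimination

/-! ### Splitting admissible sequences and comparing the ideals. -/

section Admissible

variable {q : ℕ}

theorem IsAdmissible.append_cons {α : Type*} [Preorder α] {a b : List α} {n : α}
    (ha : IsAdmissible a) (hb : IsAdmissible b) (han : ∀ s ∈ a, s < n) (hbn : ∀ s ∈ b, s < n) :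
    IsAdmissible (a ++ n :: b) := by
  have hlt : ∀ (k : ℕ) (hk : k < (a ++ n :: b).length), k ≠ a.length →
      (a ++ n :: b)[k] < n := by
    intro k hk hne
    rcases lt_or_gt_of_ne hne with h | h
    · rw [List.getElem_append_left h]
      exact han _ (List.getElem_mem _)
    · obtain ⟨d, rfl⟩ : ∃ d, k = a.length + (d + 1) := ⟨k - a.length - 1, by omega⟩
      simp only [List.length_append, List.length_cons] at hk
      have : (a ++ n :: b)[a.length + (d + 1)] = b[d] := by simp
      rw [this]
      exact hbn _ (List.getElem_mem _)
  rintro ⟨i, hi⟩ ⟨j, hj⟩ hij h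
  simp only [Fin.mk_lt_mk, List.get_eq_getElem] at hij h ⊢
  have hmid : (a ++ n :: b)[a.length]'(by simp) = n := by simp
  by_cases hia : i = a.length
  · subst hia
    exact absurd (hlt j hj (by omega)) (by rw [← h, hmid]; exact lt_irrefl n)
  by_cases hja : j = a.length
  · subst hja
    exact absurd (hlt i hi hia) (by rw [h, hmid]; exact lt_irrefl n)
  rcases lt_or_gt_of_ne hia with h1 | h1
  · rcases lt_or_gt_of_ne hja with h2 | h2
    · obtain ⟨⟨k, hk⟩, h3, h4, h5⟩ := ha ⟨i, h1⟩ ⟨j, h2⟩ hij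
        (by simpa [List.getElem_append_left, h1, h2] using h)
      refine ⟨⟨k, by simp; omega⟩, h3, h4, ?_⟩
      simpa [List.getElem_append_left, h1, hk] using h5
    · exact ⟨⟨a.length, by simp⟩, h1, h2, by simpa using hlt i hi hia⟩
  · simp only [List.length_append, List.length_cons] at hi hj
    obtain ⟨i, rfl⟩ : ∃ d, i = a.length + (d + 1) := ⟨i - a.length - 1, by omega⟩
    obtain ⟨j, rfl⟩ : ∃ d, j = a.length + (d + 1) := ⟨j - a.length - 1, by omega⟩
    obtain ⟨⟨k, hk⟩, h3, h4, h5⟩ := hb ⟨i, by omega⟩ ⟨j, by omega⟩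
      (by rw [Fin.mk_lt_mk]; omega) (by simpa using h)
    simp only [Fin.mk_lt_mk] at h3 h4
    refine ⟨⟨a.length + (k + 1), by simp; omega⟩, ?_, ?_, ?_⟩
    · rw [Fin.mk_lt_mk]; omega
    · rw [Fin.mk_lt_mk]; omega
    · simpa using h5

theorem seqProd_append_cons {α S : Type*} [CommRing S] (B : Matrix α α S) (n : α) (b : List α)
    (j : α) : ∀ (a : List α) (i : α),
      seqProd B i (a ++ n :: b) j = seqProd B i a n * seqProd B n b j
  | [], _ => rfl
  | s :: a, i => by
    simp only [List.cons_append, seqProd, seqProd_append_cons B n b j a s, mul_assoc]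

theorem IsAdmissible.isChain_ne {α : Type*} [Preorder α] {l : List α} (h : IsAdmissible l) :
    l.IsChain (· ≠ ·) := by
  rw [List.isChain_iff_getElem]
  intro i hi he
  obtain ⟨k, h1, h2, -⟩ := h ⟨i, by omega⟩ ⟨i + 1, hi⟩ (by simp) he
  rw [Fin.lt_def] at h1 h2
  simp only at h1 h2
  omega

/-- The sums of the products along the admissible sequences with entries smaller than `m`. -/
noncomputable def admissibleSum {S : Type*} [CommRing S] (B : Matrix (Fin q) (Fin q) S) (m : ℕ) :
    Matrix (Fin q) (Fin q) S :=
  fun i j => ∑ l ∈ (finite_admissible q m).toFinset, seqProd B i l j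

theorem admissibleSum_zero {S : Type*} [CommRing S] (B : Matrix (Fin q) (Fin q) S) :
    admissibleSum B 0 = B := by
  ext i j
  have : (finite_admissible q 0).toFinset = {[]} := by
    ext l
    simp only [Set.Finite.mem_toFinset, Set.mem_ofPred_eq, Finset.mem_singleton]
    constructor
    · rintro ⟨-, h⟩
      exact List.eq_nil_iff_forall_not_mem.mpr fun s hs => Nat.not_lt_zero _ (h s hs)
    · rintro rfl
      exact ⟨fun i => i.elim0, by simp⟩
  rw [admissibleSum, this, Finset.sum_singleton, seqProd]

/-- The largest allowed entry `k` occurs at most once, since nothing allowed could separate two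
copies. Conversely, `k` separates equal entries lying on its two sides. -/
theorem admissible_succ_iff (k : Fin q) (l : List (Fin q)) :
    (IsAdmissible l ∧ ∀ s ∈ l, (s : ℕ) < k + 1) ↔
      (IsAdmissible l ∧ ∀ s ∈ l, (s : ℕ) < k) ∨
      ∃ a b : List (Fin q), (IsAdmissible a ∧ ∀ s ∈ a, (s : ℕ) < k) ∧ (IsAdmissible b ∧ ∀ s ∈ b, (s : ℕ) < k) ∧
        a ++ k :: b = l := by
  constructor
  · rintro ⟨hl, h⟩
    by_cases hm : k ∈ l
    · right
      obtain ⟨a, b, rfl⟩ := List.append_of_mem hm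
      have key : ∀ (i j : ℕ) (hi : i < (a ++ k :: b).length) (hj : j < (a ++ k :: b).length),
          i < j → (a ++ k :: b)[i] = k → (a ++ k :: b)[j] = k → False := by
        intro i j hi hj hij h1 h2
        obtain ⟨r, -, -, hr⟩ := hl ⟨i, hi⟩ ⟨j, hj⟩ hij (h1.trans h2.symm)
        have h3 := h _ (List.get_mem _ r)
        rw [List.get_eq_getElem, h1, Fin.lt_def] at hr
        omega
      have hmid : (a ++ k :: b)[a.length]'(by simp) = k := by simp
      refine ⟨a, b, ⟨IsAdmissible.of_append (a := []) (c := k :: b) (by simpa using hl), ?_⟩,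
        ⟨IsAdmissible.of_append (a := a ++ [k]) (c := []) (by simpa using hl), ?_⟩, rfl⟩
      · intro s hs
        have h1 := h s (by simp [hs])
        refine lt_of_le_of_ne (by omega) fun e => ?_
        obtain ⟨i, hi, rfl⟩ := List.getElem_of_mem hs
        exact key i a.length (by simp; omega) (by simp) hi
          (by rw [List.getElem_append_left hi]; exact Fin.ext e) hmid
      · intro s hs
        have h1 := h s (by simp [hs])
        refine lt_of_le_of_ne (by omega) fun e => ?_
        obtain ⟨i, hi, rfl⟩ := List.getElem_of_mem hs
        exact key a.length (a.length + (i + 1)) (by simp) (by simp; omega) (by omega) hmid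
          (by simpa using Fin.ext e)
    · refine Or.inl ⟨hl, fun s hs => lt_of_le_of_ne (Nat.lt_succ_iff.mp (h s hs)) fun e => hm ?_⟩
      rwa [← Fin.ext e]
  · rintro (⟨hl, h⟩ | ⟨a, b, ⟨ha, ha'⟩, ⟨hb, hb'⟩, rfl⟩)
    · exact ⟨hl, fun s hs => (h s hs).trans (Nat.lt_succ_self _)⟩
    · refine ⟨ha.append_cons hb (fun s hs => ha' s hs) (fun s hs => hb' s hs), fun s hs => ?_⟩
      rcases List.mem_append.mp hs with h | h
      · have := ha' s h; omega
      · rcases List.mem_cons.mp h with rfl | h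
        · omega
        · have := hb' s h; omega

theorem append_cons_inj_of_notMem {α : Type*} {k : α} {a b c d : List α} (ha : k ∉ a)
    (hc : k ∉ c) (h : a ++ k :: b = c ++ k :: d) : a = c ∧ b = d := by
  induction a generalizing c with
  | nil =>
    cases c with
    | nil => simpa using h
    | cons x c =>
      simp only [List.nil_append, List.cons_append, List.cons.injEq] at h
      simp [h.1] at hc
  | cons y a ih =>
    cases c with
    | nil =>
      simp only [List.nil_append, List.cons_append, List.cons.injEq] at h
      simp [h.1] at ha
    | cons x c =>
      simp only [List.cons_append, List.cons.injEq] at h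
      simp only [List.mem_cons, not_or] at ha hc
      obtain ⟨rfl, rfl⟩ := ih ha.2 hc.2 h.2
      simp [h.1]

theorem admissibleSum_succ {S : Type*} [CommRing S] (B : Matrix (Fin q) (Fin q) S)
    (k i j : Fin q) : admissibleSum B (k + 1) i j =
      admissibleSum B k i j + admissibleSum B k i k * admissibleSum B k k j := by
  have hset : (finite_admissible q (k + 1)).toFinset = (finite_admissible q k).toFinset ∪
      ((finite_admissible q k).toFinset ×ˢ (finite_admissible q k).toFinset).image
        fun p => p.1 ++ k :: p.2 := by
    ext l
    simp only [Set.Finite.mem_toFinset, Finset.mem_union, Finset.mem_image, Finset.mem_product,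
      Set.mem_ofPred_eq, Prod.exists]
    rw [admissible_succ_iff]
    simp only [and_assoc]
  have hk : ∀ a : List (Fin q), a ∈ (finite_admissible q k).toFinset → k ∉ a := by
    intro a ha hka
    rw [Set.Finite.mem_toFinset] at ha
    exact lt_irrefl _ (ha.2 k hka)
  rw [admissibleSum, hset, Finset.sum_union, Finset.sum_image]
  · simp only [seqProd_append_cons, admissibleSum, Finset.sum_mul_sum, Finset.sum_product]
  · rintro ⟨a, b⟩ h1 ⟨c, d⟩ h2 h
    simp only [Finset.coe_product, Set.mem_prod, Finset.mem_coe] at h1 h2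
    obtain ⟨rfl, rfl⟩ := append_cons_inj_of_notMem (hk _ h1.1) (hk _ h2.1) h
    rfl
  · rw [Finset.disjoint_left]
    rintro l hl hl'
    obtain ⟨p, -, rfl⟩ := Finset.mem_image.mp hl'
    exact hk _ hl (by simp)

theorem diagC_eq_admissibleSum (n : Fin q) :
    diagC n = admissibleSum (Matrix.mvPolynomialX (Fin q) (Fin q) ℤ) n n n := by
  rw [diagC, admissibleSum]
  congr 1

/-- The map `f` is arbitrary because the pivots become `-1` only in a quotient, and two different
quotients are needed. -/
theorem det_map_cornerBlock {S : Type*} [CommRing S]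
    (f : MvPolynomial (Fin q × Fin q) ℤ →+* S) (n : Fin q)
    (h : ∀ k < n, f (diagC k) = -1) :
    f (cornerBlock n).det = (-1) ^ (n : ℕ) * f (diagC n) := by
  have := det_corner_of_elimination (S := S) (E := fun m => (admissibleSum
    (Matrix.mvPolynomialX (Fin q) (Fin q) ℤ) m).map f) n
    (fun k i j => by simp [admissibleSum_succ]) (fun k hk => by
      simpa [diagC_eq_admissibleSum] using h k hk)
  simp only [admissibleSum_zero, Matrix.map_apply, ← diagC_eq_admissibleSum] at this
  rw [← this, RingHom.map_det]
  rfl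

theorem minorIdeal_eq_span :
    minorIdeal q = Ideal.span (Set.range fun n : Fin q => 1 + diagC n) := by
  apply le_antisymm
  · refine Ideal.span_le.mpr ?_
    rintro _ ⟨n, rfl⟩
    have hf (k : Fin q) : Ideal.Quotient.mk (Ideal.span (Set.range fun n : Fin q => 1 + diagC n))
        (diagC k) = -1 := by
      rw [eq_neg_iff_add_eq_zero, add_comm, ← map_one (Ideal.Quotient.mk _), ← map_add,
        Ideal.Quotient.eq_zero_iff_mem]
      exact Ideal.subset_span ⟨k, rfl⟩
    rw [SetLike.mem_coe, ← Ideal.Quotient.eq_zero_iff_mem, map_sub,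
      det_map_cornerBlock _ n fun k _ => hf k, hf]
    simp only [pow_succ, map_mul, map_pow, map_neg, map_one, sub_self]
  · refine Ideal.span_le.mpr ?_
    rintro _ ⟨n, rfl⟩
    rw [SetLike.mem_coe, ← Ideal.Quotient.eq_zero_iff_mem, map_add, map_one, add_comm,
      ← eq_neg_iff_add_eq_zero]
    induction n using WellFoundedLT.induction with
    -- The earlier pivots being `-1`, the minor relation determines the next one after cancelling
    -- the unit `(-1) ^ n`.
    | _ n ih =>
      have h1 := det_map_cornerBlock (Ideal.Quotient.mk (minorIdeal q)) n ih
      have h2 : Ideal.Quotient.mk (minorIdeal q)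
          ((cornerBlock n).det - (-1) ^ ((n : ℕ) + 1)) = 0 :=
        Ideal.Quotient.eq_zero_iff_mem.mpr (Ideal.subset_span ⟨n, rfl⟩)
      rw [map_sub, h1, sub_eq_zero, map_pow, map_neg, map_one, pow_succ] at h2
      exact (isUnit_one.neg.pow _).mul_left_cancel h2

end Admissible

/-! ### Eliminating the diagonal indeterminates. -/

section OffDiagonal

variable {q : ℕ}

/-- The polynomials in the off-diagonal indeterminates. -/
noncomputable abbrev offDiagonal (q : ℕ) : Subalgebra ℤ (MvPolynomial (Fin q × Fin q) ℤ) :=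
  supported ℤ {v | v.1 ≠ v.2}

theorem mem_offDiagonal_iff {p : MvPolynomial (Fin q × Fin q) ℤ} :
    p ∈ offDiagonal q ↔ ∀ a ∈ p.support, ∀ i, a (i, i) = 0 := by
  rw [mem_supported]
  constructor
  · intro h a ha i
    by_contra hi
    exact h ((mem_vars_iff_mem_support (i, i)).mpr ⟨a, ha, by simpa using hi⟩) rfl
  · rintro h ⟨i, j⟩ hv (rfl : i = j)
    obtain ⟨a, ha, hi⟩ := (mem_vars_iff_mem_support (i, i)).mp hv
    exact (Finsupp.mem_support_iff.mp hi) (h a ha i)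

theorem seqProd_mem_offDiagonal (n : Fin q) : ∀ (l : List (Fin q)) (a : Fin q),
    (a :: l).IsChain (· ≠ ·) → (∀ s ∈ a :: l, s ≠ n) →
      seqProd (Matrix.mvPolynomialX (Fin q) (Fin q) ℤ) a l n ∈ offDiagonal q
  | [], a, _, h => X_mem_supported.mpr (h a (by simp))
  | b :: l, a, hc, h => by
    rw [List.isChain_cons_cons] at hc
    exact mul_mem (X_mem_supported.mpr hc.1) (seqProd_mem_offDiagonal n l b hc.2
      fun s hs => h s (List.mem_cons_of_mem _ hs))

/-- The empty sequence gives `X (n, n)`. In a nonempty one neighbours differ and all entries are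
below `n`, so no factor is diagonal. -/
theorem diagC_sub_X_mem_offDiagonal (n : Fin q) : diagC n - X (n, n) ∈ offDiagonal q := by
  have hnil : ([] : List (Fin q)) ∈ (finite_admissibleBelow n).toFinset := by
    rw [Set.Finite.mem_toFinset]
    exact ⟨fun i => i.elim0, by simp⟩
  rw [diagC, ← Finset.add_sum_erase _ _ hnil]
  simp only [seqProd, Matrix.mvPolynomialX_apply, add_sub_cancel_left]
  refine sum_mem fun l hl => ?_
  rw [Finset.mem_erase, Set.Finite.mem_toFinset] at hl
  obtain ⟨hne, hl, hlt⟩ := hl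
  cases l with
  | nil => exact absurd rfl hne
  | cons a l =>
    exact mul_mem (X_mem_supported.mpr (hlt a (by simp)).ne')
      (seqProd_mem_offDiagonal n l a hl.isChain_ne fun s hs => (hlt s hs).ne)

/-- Solving `1 + C_{n,n} = 0` for the diagonal indeterminates shows that the ideal contains no
nonzero polynomial in the off-diagonal ones. -/
theorem eq_zero_of_mem_minorIdeal {f : MvPolynomial (Fin q × Fin q) ℤ} (hf : f ∈ minorIdeal q)
    (ho : f ∈ offDiagonal q) : f = 0 := by
  -- The image of `X (n, n)` is the off-diagonal polynomial `-1 - (diagC n - X (n, n))`, the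
  -- solution of `1 + diagC n = 0`.
  let φ : MvPolynomial (Fin q × Fin q) ℤ →+* MvPolynomial (Fin q × Fin q) ℤ :=
    eval₂Hom C fun v => if v.1 = v.2 then X v - (1 + diagC v.1) else X v
  have hfix : ∀ p ∈ offDiagonal q, φ p = p := by
    intro p hp
    refine (hom_congr_vars (f₁ := φ) (f₂ := RingHom.id _) ?_ ?_ rfl).trans rfl
    · ext; simp
    · intro v hv _
      have : v.1 ≠ v.2 := mem_supported.mp hp hv
      simp [φ, this]
  have hker : minorIdeal q ≤ RingHom.ker φ := by
    rw [minorIdeal_eq_span, Ideal.span_le]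
    rintro _ ⟨n, rfl⟩
    have h1 := hfix _ (diagC_sub_X_mem_offDiagonal n)
    have h2 : φ (X (n, n)) = X (n, n) - (1 + diagC n) := by simp [φ]
    rw [map_sub, h2] at h1
    rw [SetLike.mem_coe, RingHom.mem_ker, map_add, map_one]
    linear_combination h1
  rw [← hfix f ho]
  exact hker hf

end OffDiagonal

/-! ### Leading terms and uniqueness of the reduced basis. -/

section TermOrder

variable {q : ℕ} {o : LinearOrder (Fin q × Fin q)}

theorem lexTermOrder_lt_single (ho : ∀ i j k : Fin q, j ≠ k → o.lt (j, k) (i, i))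
    {a : Fin q × Fin q →₀ ℕ} (ha : ∀ i, a (i, i) = 0) (n : Fin q) :
    (lexTermOrder o).toSyn a < (lexTermOrder o).toSyn (Finsupp.single (n, n) 1) := by
  rw [lexTermOrder_lt_iff]
  refine ⟨(n, n), ?_, by simp [ha]⟩
  rintro ⟨j, k⟩ hw
  have hne : (j, k) ≠ (n, n) := fun h => @lt_irrefl _ o.toPreorder _ (h ▸ hw)
  rw [Finsupp.single_eq_of_ne hne]
  by_cases hjk : j = k
  · rw [← hjk, ha]
  · exact absurd (ho n j k hjk) (@lt_asymm _ o.toPreorder _ _ hw)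

theorem single_le_of_ne_zero {σ : Type*} {a : σ →₀ ℕ} {v : σ} (h : a v ≠ 0) :
    Finsupp.single v 1 ≤ a := by
  rw [Finsupp.single_le_iff]
  omega

theorem degree_lt_single (ho : ∀ i j k : Fin q, j ≠ k → o.lt (j, k) (i, i))
    {p : MvPolynomial (Fin q × Fin q) ℤ} (hp : p ∈ offDiagonal q) (n : Fin q) :
    (lexTermOrder o).toSyn ((lexTermOrder o).degree p) <
      (lexTermOrder o).toSyn (Finsupp.single (n, n) 1) :=
  -- The bound must itself exceed the zero exponent, which covers `p = 0`.
  ((lexTermOrder o).degree_lt_iff (lexTermOrder_lt_single ho (fun _ => rfl) n)).mpr fun _ ha =>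
    lexTermOrder_lt_single ho (mem_offDiagonal_iff.mp hp _ ha) n

theorem one_add_diagC_eq (n : Fin q) : ∃ p ∈ offDiagonal q, 1 + diagC n = X (n, n) + p :=
  ⟨1 + (diagC n - X (n, n)), add_mem (one_mem _) (diagC_sub_X_mem_offDiagonal n), by ring⟩

theorem degree_one_add_diagC (ho : ∀ i j k : Fin q, j ≠ k → o.lt (j, k) (i, i)) (n : Fin q) :
    (lexTermOrder o).degree (1 + diagC n) = Finsupp.single (n, n) 1 := by
  obtain ⟨p, hp, h⟩ := one_add_diagC_eq n
  rw [h, MonomialOrder.degree_add_of_lt, MonomialOrder.degree_X]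
  rw [MonomialOrder.degree_X]
  exact degree_lt_single ho hp n

theorem monic_one_add_diagC (ho : ∀ i j k : Fin q, j ≠ k → o.lt (j, k) (i, i)) (n : Fin q) :
    (lexTermOrder o).Monic (1 + diagC n) := by
  obtain ⟨p, hp, h⟩ := one_add_diagC_eq n
  rw [h]
  refine MonomialOrder.Monic.add_of_lt MonomialOrder.leadingCoeff_X ?_
  rw [MonomialOrder.degree_X]
  exact degree_lt_single ho hp n

theorem leadingTerm_one_add_diagC (ho : ∀ i j k : Fin q, j ≠ k → o.lt (j, k) (i, i)) (n : Fin q) :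
    (lexTermOrder o).leadingTerm (1 + diagC n) = X (n, n) := by
  rw [MonomialOrder.leadingTerm, degree_one_add_diagC ho,
    (monic_one_add_diagC ho n).leadingCoeff_eq_one]
  rfl

theorem one_add_diagC_mem (n : Fin q) : 1 + diagC n ∈ minorIdeal q := by
  rw [minorIdeal_eq_span]
  exact Ideal.subset_span ⟨n, rfl⟩

/-- Monomials containing a diagonal indeterminate exceed all those without. An off-diagonal leading
monomial would thus make all of `f` off-diagonal, hence zero. -/
theorem exists_degree_apply_ne_zero (ho : ∀ i j k : Fin q, j ≠ k → o.lt (j, k) (i, i))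
    {f : MvPolynomial (Fin q × Fin q) ℤ} (hf : f ∈ minorIdeal q) (h0 : f ≠ 0) :
    ∃ n, (lexTermOrder o).degree f (n, n) ≠ 0 := by
  by_contra! h
  refine h0 (eq_zero_of_mem_minorIdeal hf (mem_offDiagonal_iff.mpr fun a ha i => ?_))
  by_contra hi
  exact absurd (((lexTermOrder o).toSyn_monotone (single_le_of_ne_zero hi)).trans
    ((lexTermOrder o).le_degree ha)) (lexTermOrder_lt_single ho h i).not_ge

theorem initialIdeal_minorIdeal (ho : ∀ i j k : Fin q, j ≠ k → o.lt (j, k) (i, i)) :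
    initialIdeal (lexTermOrder o) (minorIdeal q) =
      Ideal.span (Set.range fun n : Fin q => (X (n, n) : MvPolynomial (Fin q × Fin q) ℤ)) := by
  apply le_antisymm
  · refine Ideal.span_le.mpr ?_
    rintro _ ⟨f, hf, rfl⟩
    by_cases h0 : f = 0
    · simp [h0]
    obtain ⟨n, hn⟩ := exists_degree_apply_ne_zero ho hf h0
    refine Ideal.mem_of_dvd _ ?_ (Ideal.subset_span ⟨n, rfl⟩)
    exact X_dvd_monomial.mpr (Or.inr hn)
  · refine Ideal.span_le.mpr ?_
    rintro _ ⟨n, rfl⟩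
    exact Ideal.subset_span ⟨_, one_add_diagC_mem n, leadingTerm_one_add_diagC ho n⟩

theorem isReducedGroebnerBasis_one_add_diagC
    (ho : ∀ i j k : Fin q, j ≠ k → o.lt (j, k) (i, i)) :
    IsReducedGroebnerBasis (lexTermOrder o)
      (Set.range fun n : Fin q => 1 + diagC n) (minorIdeal q) where
  finite := Set.finite_range _
  subset := by
    rintro _ ⟨n, rfl⟩
    exact one_add_diagC_mem n
  span_leadingTerm := by
    rw [initialIdeal_minorIdeal ho, ← Set.range_comp]
    simp only [Function.comp_def, leadingTerm_one_add_diagC ho]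
  monic := by
    rintro _ ⟨n, rfl⟩
    exact monic_one_add_diagC ho n
  reduced := by
    rintro _ ⟨n, rfl⟩ _ ⟨m, rfl⟩ hne a ha hle
    simp only [degree_one_add_diagC ho, Finsupp.single_le_iff] at hle
    have hmn : (n, n) ≠ (m, m) := by
      rintro h
      obtain rfl : n = m := congrArg Prod.fst h
      exact hne rfl
    obtain ⟨p, hp, h⟩ := one_add_diagC_eq n
    simp only [h] at ha
    classical
    rcases Finset.mem_union.mp (support_add ha) with ha | ha
    · rw [support_X, Finset.mem_singleton] at ha
      rw [ha, Finsupp.single_eq_of_ne hmn.symm] at hle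
      omega
    · rw [mem_offDiagonal_iff.mp hp a ha m] at hle
      omega

/-- A reduced Gröbner basis contains, for each `n`, an element with leading monomial `B_{n,n}`. -/
theorem exists_mem_degree_eq_single (ho : ∀ i j k : Fin q, j ≠ k → o.lt (j, k) (i, i))
    {G : Set (MvPolynomial (Fin q × Fin q) ℤ)}
    (hG : IsReducedGroebnerBasis (lexTermOrder o) G (minorIdeal q)) (n : Fin q) :
    ∃ g ∈ G, (lexTermOrder o).degree g = Finsupp.single (n, n) 1 := by
  have hX : (X (n, n) : MvPolynomial (Fin q × Fin q) ℤ) ∈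
      Ideal.span ((fun s => monomial s (1 : ℤ)) '' ((lexTermOrder o).degree '' G)) := by
    have : (fun s => monomial s (1 : ℤ)) '' ((lexTermOrder o).degree '' G) =
        (lexTermOrder o).leadingTerm '' G := by
      rw [Set.image_image]
      refine Set.image_congr fun g hg => ?_
      rw [MonomialOrder.leadingTerm, (hG.monic g hg).leadingCoeff_eq_one]
    rw [this, hG.span_leadingTerm, initialIdeal_minorIdeal ho]
    exact Ideal.subset_span ⟨n, rfl⟩
  rw [mem_ideal_span_monomial_image] at hX
  obtain ⟨_, ⟨g, hg, rfl⟩, hle⟩ := hX (Finsupp.single (n, n) 1) (by simp [support_X])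
  refine ⟨g, hg, le_antisymm hle ?_⟩
  obtain ⟨m, hm⟩ := exists_degree_apply_ne_zero ho (hG.subset hg) (hG.monic g hg).ne_zero
  have hmn : (m, m) = (n, n) := by
    by_contra h
    have := hle (m, m)
    rw [Finsupp.single_eq_of_ne h] at this
    omega
  exact single_le_of_ne_zero (hmn ▸ hm)

/-- A non-leading monomial of `g` cannot contain `X (n, n)`, by maximality of the degree, nor
another `X (i, i)`, by reducedness. So `g` and `1 + diagC n` differ by an off-diagonal element of
the ideal, which is `0`. -/
theorem eq_one_add_diagC_of_degree (ho : ∀ i j k : Fin q, j ≠ k → o.lt (j, k) (i, i))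
    {G : Set (MvPolynomial (Fin q × Fin q) ℤ)}
    (hG : IsReducedGroebnerBasis (lexTermOrder o) G (minorIdeal q)) {n : Fin q}
    {g : MvPolynomial (Fin q × Fin q) ℤ} (hg : g ∈ G)
    (hd : (lexTermOrder o).degree g = Finsupp.single (n, n) 1) : g = 1 + diagC n := by
  obtain ⟨p, hp, h⟩ := one_add_diagC_eq n
  have hoff : g - X (n, n) ∈ offDiagonal q := by
    refine mem_offDiagonal_iff.mpr fun a ha i => ?_
    by_contra hi
    have hne : a ≠ Finsupp.single (n, n) 1 := by
      rintro rfl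
      have h1 := (hG.monic g hg).coeff_degree
      rw [hd] at h1
      simp [h1] at ha
    have hag : a ∈ g.support := by
      rw [mem_support_iff] at ha ⊢
      rwa [coeff_sub, coeff_X, if_neg hne.symm, sub_zero] at ha
    by_cases hin : i = n
    · subst hin
      have h1 := (lexTermOrder o).le_degree hag
      rw [hd] at h1
      exact hne ((lexTermOrder o).toSyn.injective
        (le_antisymm h1 ((lexTermOrder o).toSyn_monotone (single_le_of_ne_zero hi))))
    · obtain ⟨g', hg', hd'⟩ := exists_mem_degree_eq_single ho hG i
      refine hG.reduced g hg g' hg' ?_ a hag (hd' ▸ single_le_of_ne_zero hi)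
      rintro rfl
      rw [hd, Finsupp.single_left_inj one_ne_zero] at hd'
      exact hin (congrArg Prod.fst hd').symm
  rw [← sub_eq_zero]
  refine eq_zero_of_mem_minorIdeal (sub_mem (hG.subset hg) (one_add_diagC_mem n)) ?_
  rw [h, ← sub_sub]
  exact sub_mem hoff hp

theorem eq_range_of_isReducedGroebnerBasis (ho : ∀ i j k : Fin q, j ≠ k → o.lt (j, k) (i, i))
    {G : Set (MvPolynomial (Fin q × Fin q) ℤ)}
    (hG : IsReducedGroebnerBasis (lexTermOrder o) G (minorIdeal q)) :
    G = Set.range fun n : Fin q => 1 + diagC n := by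
  ext g
  constructor
  · intro hg
    have h0 := (hG.monic g hg).ne_zero
    obtain ⟨n, hn⟩ := exists_degree_apply_ne_zero ho (hG.subset hg) h0
    obtain ⟨g', hg', hd'⟩ := exists_mem_degree_eq_single ho hG n
    have : g' = g := by
      by_contra hne
      exact hG.reduced g hg g' hg' hne _ ((lexTermOrder o).degree_mem_support h0)
        (hd' ▸ single_le_of_ne_zero hn)
    subst this
    exact ⟨n, (eq_one_add_diagC_of_degree ho hG hg hd').symm⟩
  · rintro ⟨n, rfl⟩
    obtain ⟨g, hg, hd⟩ := exists_mem_degree_eq_single ho hG n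
    simpa only [← eq_one_add_diagC_of_degree ho hG hg hd] using hg

end TermOrder

theorem mainTheorem4 (q : ℕ) (o : LinearOrder (Fin q × Fin q))
    (ho : ∀ i j k : Fin q, j ≠ k → o.lt (j, k) (i, i)) :
    IsReducedGroebnerBasis (lexTermOrder o)
        (Set.range fun n : Fin q => 1 + diagC n) (minorIdeal q) ∧
      (∀ G : Set (MvPolynomial (Fin q × Fin q) ℤ),
        IsReducedGroebnerBasis (lexTermOrder o) G (minorIdeal q) →
          G = Set.range fun n : Fin q => 1 + diagC n) ∧
      initialIdeal (lexTermOrder o) (minorIdeal q) =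
        Ideal.span (Set.range fun n : Fin q =>
          (X (n, n) : MvPolynomial (Fin q × Fin q) ℤ)) := by
  exact ⟨isReducedGroebnerBasis_one_add_diagC ho,
    fun _ hG => eq_range_of_isReducedGroebnerBasis ho hG, initialIdeal_minorIdeal ho⟩
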